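/- Theorem 6. The triangular lattice is the graph with vertex set $\mathbb{Z}^2$ in which the neighbors of $(x,y)$ are the six vertices $(x\pm 1,y)$, $(x,y\pm 1)$, $(x-1,y+1)$ and $(x+1,y-1)$. For integers $a\ge 0$ and $b\ge 1$, a graph $G$ is $(a,b)$-colorable if, for every set $A$ of $a$ colors, one can assign to each vertex $v$ of $G$ a subset $c(v)\subseteq A$ with $|c(v)|=b$ such that $c(v)\cap c(v')=\emptyset$ whenever $v$ and $v'$ are adjacent. Let $\mathcal{R}$ be a triangle-free induced subgraph (finite or infinite) of the triangular lattice. Then $\mathcal{R}$ is $(a,b)$-colorable for all integers $a\ge 0$, $b\ge 1$ with $\frac{a}{b}\ge\frac{7}{3}$. In particular, $\mathcal{R}$ is $(7,3)$-colorable. -/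

import Mathlib

/-- The triangular lattice, in the coordinates given by two unit vectors of the plane at an
angle of sixty degrees: the vertices are the integer pairs, and the six neighbors of `(x, y)` are
`(x - 1, y)`, `(x + 1, y)`, `(x - 1, y + 1)`, `(x, y + 1)`, `(x, y - 1)`, `(x + 1, y - 1)`. -/
def triangularLattice : SimpleGraph (ℤ × ℤ) where
  Adj p q :=
    q = (p.1 - 1, p.2) ∨ q = (p.1 + 1, p.2) ∨
    q = (p.1 - 1, p.2 + 1) ∨ q = (p.1, p.2 + 1) ∨
    q = (p.1, p.2 - 1) ∨ q = (p.1 + 1, p.2 - 1)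
  symm := ⟨by
    rintro ⟨x, y⟩ ⟨z, w⟩ h
    simp only [Prod.mk.injEq] at h ⊢
    omega⟩
  loopless := ⟨by
    rintro ⟨x, y⟩ h
    simp only [Prod.mk.injEq] at h
    omega⟩

/-- `c` is an `(L, ω)`-choosability of `G`: each `c v` is a set of `ω v` colors of the list `L v`,
and adjacent vertices receive disjoint sets. -/
def IsChoosability {V : Type*} (G : SimpleGraph V) (L : V → Finset ℕ) (ω : V → ℕ)
    (c : V → Finset ℕ) : Prop :=
  (∀ v, c v ⊆ L v ∧ (c v).card = ω v) ∧ ∀ v w, G.Adj v w → Disjoint (c v) (c w)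

/-- `G` is `(a, b)`-colorable: for every `a`-list `L` of `G` which is the same at all vertices
there is an `(L, b)`-choosability of `G`. -/
def IsColorableAB {V : Type*} (G : SimpleGraph V) (a b : ℕ) : Prop :=
  ∀ L : V → Finset ℕ, (∀ v, (L v).card = a) → (∀ v w, L v = L w) →
    ∃ c : V → Finset ℕ, IsChoosability G L (fun _ => b) c

/-- `G` belongs to the class of graphs that are `(a, b)`-colorable for all `a`, `b` with `b ≥ 1`
and `a / b ≥ x`. -/
def MemColorClass {V : Type*} (x : ℚ) (G : SimpleGraph V) : Prop :=
  ∀ a b : ℕ, 1 ≤ b → x ≤ (a : ℚ) / (b : ℚ) → IsColorableAB G a b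

/-! The core is a homomorphism to the Kneser graph K(7,3) of triples in a seven-element set. By
compactness it suffices to treat finite vertex sets, which are colored row by row from below, each
row from left to right.

A row can be extended upwards only if its colors allow it. If the next row has a run of consecutive
vertices joining a neighbor of `m` to a neighbor of `n`, the two colors must be joined by a walk in
K(7,3). The ends of walks of length 2, 3, 4, 5 from a triple `C` are the triples meeting `C` in at
least 2, at most 1, at least 1, at most 2 points; longer walks reach everything. Hence the default
conditions of `RowRel` for gaps 2, 3, 4 are those of walks of length 3, 4, 5. In the two exceptional
cases the run above is broken, and the condition is replaced by the one that the resulting gap in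
the next row needs.

To show that a row with `RowValid` has a coloring above it that is again `RowValid`, one tracks the
set of colors reachable at the current vertex. `Supply` lists lower bounds for this set, and the
lemmas `Supply.succ`, `Supply.add_two`, `Supply.add_three` and `Supply.add_four` preserve it over
each possible gap.

Finally, K(7,3) has (7,3)-, (5,2)- and (3,1)-colorings, and sums of these give every ratio at least
7/3. -/

/-! ### Triples in a seven-element set, checked by computation -/

/-- The three-element subsets of `{0, …, 6}`, listed as seven-digit bit masks, are packed into one
number; `tripleMask i` is the mask of the `i`-th of them. -/
def tripleMask (i : Fin 35) : ℕ :=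
  Nat.mod (Nat.shiftRight
    49832993059746847230055807547369762320180794728785858942096215776518522247
    (Nat.mul 7 i.val)) 128

/-- The size of the intersection of the triples `i` and `j`, read off from a packed table of the
numbers of ones (capped at three) in the seven-digit bit masks. -/
def interSize (i j : Fin 35) : ℕ :=
  Nat.mod (Nat.shiftRight
    115792089237316195417293883271839703056759595789505949035534252942017123969428
    (Nat.mul 2 (Nat.land (tripleMask i) (tripleMask j)))) 4

theorem interSize_comm (i j : Fin 35) : interSize i j = interSize j i := by
  unfold interSize
  rw [show Nat.land (tripleMask i) (tripleMask j) = Nat.land (tripleMask j) (tripleMask i) from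
    Nat.and_comm _ _]

/-- Whether `p` holds for all `i : Fin n`; unlike the library's decision procedure for bounded
quantifiers this one evaluates `p` at numerals, which the kernel does quickly. -/
def finAll {n : ℕ} (p : Fin n → Bool) : Bool :=
  Nat.rec (motive := fun m => m ≤ n → Bool) (fun _ => true)
    (fun k r h => and (p ⟨k, h⟩) (r (Nat.le_of_succ_le h))) n (Nat.le_refl n)

theorem finAll_eq_true {n : ℕ} (p : Fin n → Bool) : finAll p = true ↔ ∀ i, p i = true := by
  have key : ∀ m (hm : m ≤ n), (Nat.rec (motive := fun m => m ≤ n → Bool) (fun _ => true)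
      (fun k r h => and (p ⟨k, h⟩) (r (Nat.le_of_succ_le h))) m hm : Bool) = true ↔
      ∀ i : Fin n, i.val < m → p i = true := by
    intro m
    induction m with
    | zero => simp
    | succ k ih =>
      intro hm
      simp only [Bool.and_eq_true, ih]
      constructor
      · rintro ⟨h₁, h₂⟩ i hi
        rcases Nat.lt_succ_iff_lt_or_eq.mp hi with h | h
        · exact h₂ i h
        · rw [show i = ⟨k, hm⟩ from Fin.ext h]
          exact h₁
      · exact fun h => ⟨h _ (Nat.lt_succ_self k), fun i hi => h i (Nat.lt_succ_of_lt hi)⟩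
  exact (key n (Nat.le_refl n)).trans ⟨fun h i => h i i.isLt, fun h i _ => h i⟩

instance decidableForallFin35 (P : Fin 35 → Prop) [DecidablePred P] : Decidable (∀ i, P i) :=
  decidable_of_iff (finAll (fun i => decide (P i)) = true) (by simp [finAll_eq_true])

instance decidableExistsFin35 (P : Fin 35 → Prop) [DecidablePred P] : Decidable (∃ i, P i) :=
  decidable_of_iff (finAll (fun i => decide (¬ P i)) = false) (by
    rw [← Bool.not_eq_true, finAll_eq_true]
    simp)

theorem interSize_le_two_iff : ∀ i j : Fin 35, interSize i j ≤ 2 ↔ i ≠ j := by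
  decide +kernel

/-- Two distinct triples cover at least four points, so at most one triple avoids both. Hypotheses
are interleaved with quantifiers so that the evaluation can stop early. -/
theorem eq_of_disjoint : ∀ Y₁ X : Fin 35, interSize Y₁ X = 0 → ∀ Y₂, interSize Y₂ X = 0 → Y₁ ≠ Y₂ →
    ∀ X', interSize Y₁ X' = 0 → interSize Y₂ X' = 0 → X' = X := by
  decide +kernel

theorem exists_meets_of_ne (Y₁ Y₂ : Fin 35) (h : Y₁ ≠ Y₂) :
    ∃ B, ∀ X, X ≠ B → 1 ≤ interSize Y₁ X ∨ 1 ≤ interSize Y₂ X := by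
  by_cases hB : ∃ B, interSize Y₁ B = 0 ∧ interSize Y₂ B = 0
  · obtain ⟨B, h₁, h₂⟩ := hB
    refine ⟨B, fun X hX => ?_⟩
    by_contra hc
    exact hX (eq_of_disjoint Y₁ B h₁ Y₂ h₂ h X (by omega) (by omega))
  · refine ⟨0, fun X _ => ?_⟩
    by_contra hc
    exact hB ⟨X, by omega, by omega⟩

theorem exists_two_two_le : ∀ B : Fin 35, ∃ Z₁, 2 ≤ interSize Z₁ B ∧
    ∃ Z₂, 2 ≤ interSize Z₂ B ∧ Z₁ ≠ Z₂ := by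
  decide +kernel

theorem exists_two_disjoint : ∀ C B : Fin 35, 
    ∃ X₁, (interSize C X₁ = 0 ∧ X₁ ≠ B) ∧ ∃ X₂, (interSize C X₂ = 0 ∧ X₂ ≠ B) ∧ X₁ ≠ X₂ := by
  decide +kernel

/-- Distinct triples `Y₁`, `Y₂` in the four-point complement of `D` cover it, so a triple avoiding
both is `D`. -/
theorem meets_of_two_disjoint : ∀ D Y₁ : Fin 35, interSize D Y₁ = 0 → ∀ Y₂, interSize D Y₂ = 0 →
    Y₁ ≠ Y₂ → ∀ X, X ≠ D → 1 ≤ interSize Y₁ X ∨ 1 ≤ interSize Y₂ X := by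
  decide +kernel

theorem exists_le_one_one_le : ∀ Z X : Fin 35, ∃ Y, interSize Z Y ≤ 1 ∧ 1 ≤ interSize Y X := by
  decide +kernel

theorem exists_le_one_le_one : ∀ Z X : Fin 35, ∃ Y, interSize Z Y ≤ 1 ∧ interSize Y X ≤ 1 := by
  decide +kernel

theorem exists_two_le_one_le : ∀ Z X : Fin 35, ∃ Y, 2 ≤ interSize Z Y ∧ 1 ≤ interSize Y X := by
  decide +kernel

theorem exists_one_le_le_one : ∀ Z X : Fin 35, ∃ Y, 1 ≤ interSize Z Y ∧ interSize Y X ≤ 1 := by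
  decide +kernel

theorem exists_two_le_le_one : ∀ Z X : Fin 35, X ≠ Z →
    ∃ Y, 2 ≤ interSize Z Y ∧ interSize Y X ≤ 1 := by
  decide +kernel

/-- Only one point lies outside both `D` and `C`, and `Y`, `X` can share no other. -/
theorem le_one_of_disjoint : ∀ D C : Fin 35, interSize D C = 0 → ∀ Y, interSize D Y = 0 →
    ∀ X, interSize C X = 0 → interSize Y X ≤ 1 := by
  decide +kernel

/-- `D` has two points outside `C`, and only one point outside `C` is not in `X`. -/
theorem one_le_of_le_one : ∀ C X : Fin 35, interSize C X = 0 → ∀ D, interSize D C ≤ 1 →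
    1 ≤ interSize D X := by
  decide +kernel

theorem one_le_of_disjoint : ∀ D M : Fin 35, interSize D M = 0 → ∀ C, interSize M C ≤ 1 →
    1 ≤ interSize D C := by
  decide +kernel

/-- The four-point complement of `C` contains at most two points of `X`; omitting one of them leaves
a suitable triple. -/
theorem exists_two_disjoint_le_one : ∀ C X : Fin 35, 1 ≤ interSize C X →
    ∃ Y₁, (interSize C Y₁ = 0 ∧ interSize Y₁ X ≤ 1) ∧
      ∃ Y₂, (interSize C Y₂ = 0 ∧ interSize Y₂ X ≤ 1) ∧ Y₁ ≠ Y₂ := by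
  decide +kernel

theorem exists_two_disjoint_one_le : ∀ C D : Fin 35, C ≠ D →
    ∃ X₁, (interSize D X₁ = 0 ∧ 1 ≤ interSize C X₁) ∧
      ∃ X₂, (interSize D X₂ = 0 ∧ 1 ≤ interSize C X₂) ∧ X₁ ≠ X₂ := by
  decide +kernel

theorem exists_two_disjoint_two_le : ∀ C D : Fin 35, interSize C D ≤ 1 →
    ∃ X₁, (interSize D X₁ = 0 ∧ 2 ≤ interSize C X₁) ∧
      ∃ X₂, (interSize D X₂ = 0 ∧ 2 ≤ interSize C X₂) ∧ X₁ ≠ X₂ := by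
  decide +kernel

theorem exists_two_disjoint_le_one' : ∀ C D : Fin 35, 1 ≤ interSize C D →
    ∃ X₁, (interSize D X₁ = 0 ∧ interSize C X₁ ≤ 1) ∧
      ∃ X₂, (interSize D X₂ = 0 ∧ interSize C X₂ ≤ 1) ∧ X₁ ≠ X₂ := by
  decide +kernel

/-- This and the next three lemmas describe the ends of walks of length 2, 3, 4, 5 from `C`, each
splitting off the last edge. -/
theorem exists_zero_zero : ∀ C X : Fin 35, 2 ≤ interSize C X →
    ∃ Y, interSize C Y = 0 ∧ interSize Y X = 0 := by
  decide +kernel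

theorem exists_two_le_zero : ∀ C X : Fin 35, interSize C X ≤ 1 →
    ∃ Y, 2 ≤ interSize C Y ∧ interSize Y X = 0 := by
  decide +kernel

theorem exists_le_one_zero : ∀ C X : Fin 35, 1 ≤ interSize C X →
    ∃ Y, interSize C Y ≤ 1 ∧ interSize Y X = 0 := by
  decide +kernel

theorem exists_one_le_zero : ∀ C X : Fin 35, X ≠ C →
    ∃ Y, 1 ≤ interSize C Y ∧ interSize Y X = 0 := by
  decide +kernel

theorem exists_disjoint_of_ne (Z₁ Z₂ : Fin 35) (h : Z₁ ≠ Z₂) : ∃ B, ∀ X, X ≠ B →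
    ∃ Y, (interSize Z₁ Y ≤ 1 ∨ interSize Z₂ Y ≤ 1) ∧ interSize Y X = 0 := by
  obtain ⟨B, hB⟩ := exists_meets_of_ne Z₁ Z₂ h
  refine ⟨B, fun X hX => ?_⟩
  rcases hB X hX with h₁ | h₁
  · obtain ⟨Y, h₂, h₃⟩ := exists_le_one_zero Z₁ X h₁
    exact ⟨Y, .inl h₂, h₃⟩
  · obtain ⟨Y, h₂, h₃⟩ := exists_le_one_zero Z₂ X h₁
    exact ⟨Y, .inr h₂, h₃⟩

/-! ### Row conditions and reachable colors -/

/-- The condition on the colors `Y`, `X` of two consecutive vertices `m < n` of a row, when `q` is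
the set of vertices of the next row. -/
def RowRel (q : ℤ → Prop) (m n : ℤ) (Y X : Fin 35) : Prop :=
  (n = m + 1 → interSize Y X = 0) ∧
  (n = m + 2 → (q (m - 1) ∧ q (m + 2) → 1 ≤ interSize Y X) ∧
    (¬ (q (m - 1) ∧ q (m + 2)) → interSize Y X ≤ 1)) ∧
  (n = m + 3 → (q m ∧ ¬ q (m + 1) ∧ q (m + 2) → interSize Y X ≤ 2) ∧
    (¬ (q m ∧ ¬ q (m + 1) ∧ q (m + 2)) → 1 ≤ interSize Y X)) ∧
  (n = m + 4 → interSize Y X ≤ 2)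

/-- `c` satisfies the conditions of `RowRel` at all pairs of consecutive vertices of the row `p`. -/
def RowValid (p q : ℤ → Prop) (c : ℤ → Fin 35) : Prop :=
  ∀ m n, m < n → p m → p n → (∀ i, m < i → i < n → ¬ p i) → RowRel q m n (c m) (c n)

/-- The color `X` at the vertex `n` is compatible with the colors `c` of its neighbors in the row
`l` below. -/
def BelowCompat (l : ℤ → Prop) (c : ℤ → Fin 35) (n : ℤ) (X : Fin 35) : Prop :=
  (l n → interSize (c n) X = 0) ∧ (l (n + 1) → interSize (c (n + 1)) X = 0)

/-- `f` colors the part of the row `u` up to `N` as required. -/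
def ValidUpTo (l u w : ℤ → Prop) (c : ℤ → Fin 35) (N : ℤ) (f : ℤ → Fin 35) : Prop :=
  (∀ n ≤ N, u n → BelowCompat l c n (f n)) ∧
  ∀ m n, n ≤ N → m < n → u m → u n → (∀ i, m < i → i < n → ¬ u i) → RowRel w m n (f m) (f n)

/-- Some admissible coloring of the row `u` up to `n` gives the color `X` to `n`. -/
def Reachable (l u w : ℤ → Prop) (c : ℤ → Fin 35) (n : ℤ) (X : Fin 35) : Prop :=
  ∃ f, f n = X ∧ ValidUpTo l u w c n f

section

variable {l u w : ℤ → Prop} {c : ℤ → Fin 35}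

theorem ValidUpTo.update_of_prev {m n : ℤ} {f : ℤ → Fin 35} {X : Fin 35}
    (hf : ValidUpTo l u w c m f) (hmn : m < n)
    (hno : ∀ i, m < i → i < n → ¬ u i) (hc : BelowCompat l c n X)
    (hrel : ∀ k ≤ m, u k → (∀ i, k < i → i < n → ¬ u i) → RowRel w k n (f k) X) :
    ValidUpTo l u w c n (Function.update f n X) := by
  constructor
  · intro k hk huk
    rcases eq_or_ne k n with rfl | hkn
    · simpa using hc
    · rw [Function.update_of_ne hkn]
      refine hf.1 k ?_ huk
      by_contra hlt
      exact hno k (by omega) (by omega) huk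
  · intro a b hb hab hua hub hnone
    have ha : a ≤ m := by
      by_contra hlt
      exact hno a (by omega) (by omega) hua
    rw [Function.update_of_ne (by omega : a ≠ n)]
    rcases eq_or_ne b n with rfl | hbn
    · rw [Function.update_self]
      exact hrel a ha hua hnone
    · rw [Function.update_of_ne hbn]
      refine hf.2 a b ?_ hab hua hub hnone
      by_contra hlt
      exact hno b (by omega) (by omega) hub

theorem Reachable.step {m n : ℤ} {Y X : Fin 35} (hY : Reachable l u w c m Y) (hm : u m)
    (hmn : m < n) (hno : ∀ i, m < i → i < n → ¬ u i) (hrel : RowRel w m n Y X)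
    (hc : BelowCompat l c n X) : Reachable l u w c n X := by
  obtain ⟨f, rfl, hf⟩ := hY
  refine ⟨Function.update f n X, by simp, hf.update_of_prev hmn hno hc ?_⟩
  intro k hk huk hnone
  rcases eq_or_lt_of_le hk with rfl | hlt
  · exact hrel
  · exact absurd hm (hnone m hlt hmn)

/-- `RowRel` is vacuous for gaps larger than four, so any color compatible with the row below may
start afresh. -/
theorem ValidUpTo.reachable_of_far {n : ℤ} {f : ℤ → Fin 35} {X : Fin 35}
    (hf : ValidUpTo l u w c (n - 1) f) (hno : ∀ i, n - 4 ≤ i → i < n → ¬ u i)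
    (hc : BelowCompat l c n X) : Reachable l u w c n X := by
  refine ⟨Function.update f n X, by simp,
    hf.update_of_prev (by omega) (fun i h₁ h₂ => by omega) hc ?_⟩
  intro k hk huk _
  have : k < n - 4 := by
    by_contra hlt
    exact hno k (by omega) (by omega) huk
  exact ⟨fun h => by omega, fun h => by omega, fun h => by omega, fun h => by omega⟩

theorem ValidUpTo.of_not_mem {n : ℤ} {f : ℤ → Fin 35} (hf : ValidUpTo l u w c (n - 1) f)
    (hn : ¬ u n) : ValidUpTo l u w c n f := by
  constructor
  · intro k hk huk
    refine hf.1 k ?_ huk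
    rcases eq_or_ne k n with rfl | h
    · exact absurd huk hn
    · omega
  · intro a b hb hab hua hub hnone
    refine hf.2 a b ?_ hab hua hub hnone
    rcases eq_or_ne b n with rfl | h
    · exact absurd hub hn
    · omega

/-! ### The supply of colors at a vertex -/

/-- What the row-coloring argument needs to know about the colors reachable at `n`, according to
the neighbors of `n` in the row below and the run of `u` that ends in `n`. -/
inductive Supply (l u w : ℤ → Prop) (c : ℤ → Fin 35) (n : ℤ) : Prop
  | left (B : Fin 35) (hl : l n)
      (h : ∀ X, interSize (c n) X = 0 → X ≠ B → Reachable l u w c n X)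
      (h' : ¬ w n → ∀ X, interSize (c n) X = 0 → Reachable l u w c n X)
  | right (k : ℤ) (hk : k = n + 1) (hl : l k) (X₁ X₂ : Fin 35) (hne : X₁ ≠ X₂)
      (d₁ : interSize (c k) X₁ = 0) (d₂ : interSize (c k) X₂ = 0)
      (h₁ : Reachable l u w c n X₁) (h₂ : Reachable l u w c n X₂)
  | free (Z₁ Z₂ : Fin 35) (hne : Z₁ ≠ Z₂)
      (h : ∀ X, interSize Z₁ X ≤ 1 ∨ interSize Z₂ X ≤ 1 → Reachable l u w c n X)
  | run_one (k : ℤ) (hk : n = k + 1) (hl : l k) (hu : u k) (hr : ¬ l (n + 1))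
      (h : ∀ X, 2 ≤ interSize (c k) X → Reachable l u w c n X)
  | run_two (k : ℤ) (hk : n = k + 2) (hl : l k) (hu : u k) (hu' : u (k + 1))
      (h : ∀ X, interSize (c k) X ≤ 1 → Reachable l u w c n X)
  | run_three (k : ℤ) (hk : n = k + 3) (hl : l k) (hu : u k) (hu' : u (k + 1)) (hu'' : u (k + 2))
      (h : ∀ X, 1 ≤ interSize (c k) X → Reachable l u w c n X)

theorem Supply.exists_two {n : ℤ} (h : Supply l u w c n) : ∃ Y₁ Y₂, Y₁ ≠ Y₂ ∧
    Reachable l u w c n Y₁ ∧ Reachable l u w c n Y₂ := by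
  cases h with
  | left B hl h h' =>
    obtain ⟨Y₁, h₁, Y₂, h₂, hne⟩ := exists_two_disjoint (c n) B
    exact ⟨Y₁, Y₂, hne, h _ h₁.1 h₁.2, h _ h₂.1 h₂.2⟩
  | right k hk hl X₁ X₂ hne d₁ d₂ h₁ h₂ => exact ⟨X₁, X₂, hne, h₁, h₂⟩
  | free Z₁ Z₂ hne h =>
    obtain ⟨Y₁, h₁, Y₂, h₂, hne⟩ := exists_two_disjoint Z₁ Z₁
    exact ⟨Y₁, Y₂, hne, h _ (.inl (by omega)), h _ (.inl (by omega))⟩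
  | run_one k hk hl hu hr h =>
    obtain ⟨Y₁, h₁, Y₂, h₂, hne⟩ := exists_two_two_le (c k)
    rw [interSize_comm] at h₁ h₂
    exact ⟨Y₁, Y₂, hne, h _ h₁, h _ h₂⟩
  | run_two k hk hl hu hu' h =>
    obtain ⟨Y₁, h₁, Y₂, h₂, hne⟩ := exists_two_disjoint (c k) (c k)
    exact ⟨Y₁, Y₂, hne, h _ (by omega), h _ (by omega)⟩
  | run_three k hk hl hu hu' hu'' h =>
    obtain ⟨Y₁, h₁, Y₂, h₂, hne⟩ := exists_two_two_le (c k)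
    rw [interSize_comm] at h₁ h₂
    exact ⟨Y₁, Y₂, hne, h _ (by omega), h _ (by omega)⟩

/-- Losing one color `B` is harmless. Under `l n` it is allowed only if `w n` holds, because `left`
promises the full set of colors otherwise. -/
theorem Supply.of_almost {n : ℤ} (hlu : ¬ (l n ∧ l (n + 1))) (B : Fin 35) (hw : l n → w n)
    (h : ∀ X, X ≠ B → BelowCompat l c n X → Reachable l u w c n X) : Supply l u w c n := by
  by_cases hl : l n
  · refine .left B hl (fun X hX hB => h X hB ⟨fun _ => hX, fun hl' => absurd ⟨hl, hl'⟩ hlu⟩)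
      (fun hw' => absurd (hw hl) hw')
  · by_cases hl' : l (n + 1)
    · obtain ⟨Y₁, h₁, Y₂, h₂, hne⟩ := exists_two_disjoint (c (n + 1)) B
      exact .right (n + 1) rfl hl' Y₁ Y₂ hne h₁.1 h₂.1
        (h _ h₁.2 ⟨fun h => absurd h hl, fun _ => h₁.1⟩)
        (h _ h₂.2 ⟨fun h => absurd h hl, fun _ => h₂.1⟩)
    · obtain ⟨Z₁, h₁, Z₂, h₂, hne⟩ := exists_two_two_le B
      refine .free Z₁ Z₂ hne fun X hX => h X ?_ ⟨fun h => absurd h hl, fun h => absurd h hl'⟩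
      rintro rfl
      omega

theorem Supply.of_all {n : ℤ} (hlu : ¬ (l n ∧ l (n + 1)))
    (h : ∀ X, BelowCompat l c n X → Reachable l u w c n X) : Supply l u w c n := by
  by_cases hl : l n
  · have h' : ∀ X, interSize (c n) X = 0 → Reachable l u w c n X := fun X hX =>
      h X ⟨fun _ => hX, fun hl' => absurd ⟨hl, hl'⟩ hlu⟩
    exact .left 0 hl (fun X hX _ => h' X hX) fun _ => h'
  · exact .of_almost hlu 0 (fun h => absurd h hl) fun X _ => h X

theorem RowValid.two (hc : RowValid l u c) {m n : ℤ} (hn : n = m + 2) (hm : l m)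
    (hno : ¬ l (m + 1)) (hln : l n) :
    (u (m - 1) ∧ u n → 1 ≤ interSize (c m) (c n)) ∧
    (¬ (u (m - 1) ∧ u n) → interSize (c m) (c n) ≤ 1) := by
  subst hn
  refine (hc m (m + 2) (by omega) hm hln ?_).2.1 rfl
  intro i h₁ h₂
  rwa [show i = m + 1 by omega]

theorem RowValid.three (hc : RowValid l u c) {m n : ℤ} (hn : n = m + 3) (hm : l m)
    (hno : ¬ l (m + 1)) (hno' : ¬ l (m + 2)) (hln : l n) :
    (u m ∧ ¬ u (m + 1) ∧ u (m + 2) → interSize (c m) (c n) ≤ 2) ∧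
    (¬ (u m ∧ ¬ u (m + 1) ∧ u (m + 2)) → 1 ≤ interSize (c m) (c n)) := by
  subst hn
  refine (hc m (m + 3) (by omega) hm hln ?_).2.2.1 rfl
  intro i h₁ h₂
  rcases (by omega : i = m + 1 ∨ i = m + 2) with rfl | rfl
  exacts [hno, hno']

theorem RowValid.four (hc : RowValid l u c) {m n : ℤ} (hn : n = m + 4) (hm : l m)
    (hno : ¬ l (m + 1)) (hno' : ¬ l (m + 2)) (hno'' : ¬ l (m + 3)) (hln : l n) :
    interSize (c m) (c n) ≤ 2 := by
  subst hn
  refine (hc m (m + 4) (by omega) hm hln ?_).2.2.2 rfl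
  intro i h₁ h₂
  rcases (by omega : i = m + 1 ∨ i = m + 2 ∨ i = m + 3) with rfl | rfl | rfl
  exacts [hno, hno', hno'']

theorem RowValid.one (hc : RowValid l u c) {m n : ℤ} (hn : n = m + 1) (hm : l m) (hln : l n) :
    interSize (c m) (c n) = 0 := by
  subst hn
  exact (hc m (m + 1) (by omega) hm hln fun i h₁ h₂ => by omega).1 rfl

end

/-! ### Preserving the supply along a row -/

/-- Three rows of a triangle-free graph: no three consecutive vertices of the zigzag
`l a, u a, l (a + 1), u (a + 1), …` are present, and no `u a, w a, u (a + 1)`. -/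
structure TriangleFreeRows (l u w : ℤ → Prop) : Prop where
  below : ∀ a b, b = a + 1 → l a → u a → ¬ l b
  between : ∀ a b, b = a + 1 → u a → u b → ¬ l b
  above : ∀ a b, b = a + 1 → u a → u b → ¬ w a

section

variable {l u w : ℤ → Prop} {c : ℤ → Fin 35}

/-- Inside a run the reachable colors are ends of walks from the color of the last lower neighbor.
When the run meets another lower neighbor, the row condition below leaves at least two of them. -/
theorem Supply.succ (ht : TriangleFreeRows l u w) (hc : RowValid l u c) {m n : ℤ}
    (hn : n = m + 1) (hum : u m) (hun : u n) (h : Supply l u w c m) : Supply l u w c n := by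
  have hln : ¬ l n := ht.between m n hn hum hun
  have hwm : ¬ w m := ht.above m n hn hum hun
  have key : ∀ Y X, Reachable l u w c m Y → interSize Y X = 0 →
      (l (n + 1) → interSize (c (n + 1)) X = 0) → Reachable l u w c n X := fun Y X hY hYX hX =>
    hY.step hum (by omega) (fun i h₁ h₂ => by omega)
      ⟨fun _ => hYX, fun h => by omega, fun h => by omega, fun h => by omega⟩
      ⟨fun h => absurd h hln, hX⟩
  have right : ∀ P : Fin 35 → Prop, (∀ X, P X → ∃ Y, Reachable l u w c m Y ∧ interSize Y X = 0) →
      l (n + 1) →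
      (∃ X₁, (interSize (c (n + 1)) X₁ = 0 ∧ P X₁) ∧
        ∃ X₂, (interSize (c (n + 1)) X₂ = 0 ∧ P X₂) ∧ X₁ ≠ X₂) →
      Supply l u w c n := by
    rintro P hP hl ⟨X₁, ⟨d₁, h₁⟩, X₂, ⟨d₂, h₂⟩, hne⟩
    obtain ⟨Y₁, hY₁, e₁⟩ := hP X₁ h₁
    obtain ⟨Y₂, hY₂, e₂⟩ := hP X₂ h₂
    exact .right (n + 1) rfl hl X₁ X₂ hne d₁ d₂ (key Y₁ X₁ hY₁ e₁ fun _ => d₁)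
      (key Y₂ X₂ hY₂ e₂ fun _ => d₂)
  cases h with
  | left B hl h h' =>
    have hP : ∀ X, 2 ≤ interSize (c m) X → ∃ Y, Reachable l u w c m Y ∧ interSize Y X = 0 := by
      intro X hX
      obtain ⟨Y, h₁, h₂⟩ := exists_zero_zero _ _ hX
      -- The walk of length 2 may need any color disjoint from `c m`; all are available since `w m`
      -- would create a triangle.
      exact ⟨Y, h' hwm Y h₁, h₂⟩
    by_cases hl' : l (n + 1)
    · refine right _ hP hl' (exists_two_disjoint_two_le _ _ ?_)
      refine (hc.two (by omega) hl (by rwa [← hn]) hl').2 fun h => ?_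
      exact ht.between (m - 1) m (by omega) h.1 hum hl
    · refine .run_one m hn hl hum hl' fun X hX => ?_
      obtain ⟨Y, hY, e⟩ := hP X hX
      exact key Y X hY e fun h => absurd h hl'
  | right k hk hl => exact absurd (by rwa [hk, ← hn] at hl) hln
  | free Z₁ Z₂ hne h =>
    obtain ⟨B, hB⟩ := exists_disjoint_of_ne Z₁ Z₂ hne
    refine .of_almost (fun h => hln h.1) B (fun h => absurd h hln) fun X hX hX' => ?_
    obtain ⟨Y, h₁, h₂⟩ := hB X hX
    exact key Y X (h Y h₁) h₂ hX'.2
  | run_one k hk hl hu hr h =>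
    have hP : ∀ X, interSize (c k) X ≤ 1 → ∃ Y, Reachable l u w c m Y ∧ interSize Y X = 0 := by
      intro X hX
      obtain ⟨Y, h₁, h₂⟩ := exists_two_le_zero _ _ hX
      exact ⟨Y, h Y h₁, h₂⟩
    have hlm : ¬ l m := ht.below k m hk hl hu
    by_cases hl' : l (n + 1)
    · refine right _ hP hl' (exists_two_disjoint_le_one' _ _ ?_)
      refine (hc.three (by omega) hl (by rwa [← hk]) (by rwa [show k + 2 = n by omega]) hl').2
        fun h => h.2.1 ?_
      rwa [← hk]
    · refine .run_two k (by omega) hl hu (by rwa [← hk]) fun X hX => ?_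
      obtain ⟨Y, hY, e⟩ := hP X hX
      exact key Y X hY e fun h => absurd h hl'
  | run_two k hk hl hu hu' h =>
    have hP : ∀ X, 1 ≤ interSize (c k) X → ∃ Y, Reachable l u w c m Y ∧ interSize Y X = 0 := by
      intro X hX
      obtain ⟨Y, h₁, h₂⟩ := exists_le_one_zero _ _ hX
      exact ⟨Y, h Y h₁, h₂⟩
    have hlk : ¬ l (k + 1) := ht.below k _ rfl hl hu
    have hlm : ¬ l m := ht.between (k + 1) m (by omega) hu' hum
    by_cases hl' : l (n + 1)
    · refine right _ hP hl' (exists_two_disjoint_one_le _ _ ?_)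
      exact (interSize_le_two_iff _ _).1 (hc.four (by omega) hl hlk (by rwa [← hk])
        (by rwa [show k + 3 = n by omega]) hl')
    · refine .run_three k (by omega) hl hu hu' (by rwa [← hk]) fun X hX => ?_
      obtain ⟨Y, hY, e⟩ := hP X hX
      exact key Y X hY e fun h => absurd h hl'
  | run_three k hk hl hu hu' hu'' h =>
    refine .of_almost (fun h => hln h.1) (c k) (fun h => absurd h hln) fun X hX hX' => ?_
    obtain ⟨Y, h₁, h₂⟩ := exists_one_le_zero _ _ hX
    exact key Y X (h Y h₁) h₂ hX'.2

theorem Supply.add_two (ht : TriangleFreeRows l u w) (hc : RowValid l u c) {m n : ℤ}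
    (hn : n = m + 2) (hum : u m) (hno : ¬ u (m + 1)) (hun : u n) (h : Supply l u w c m) :
    Supply l u w c n := by
  have hlu : ¬ (l n ∧ l (n + 1)) := fun h => ht.below n _ rfl h.1 hun h.2
  have hrun : ∀ Y X, Reachable l u w c m Y → (w (m - 1) ∧ w (m + 2) → 1 ≤ interSize Y X) →
      (¬ (w (m - 1) ∧ w (m + 2)) → interSize Y X ≤ 1) → BelowCompat l c n X →
      Reachable l u w c n X := fun Y X hY h₁ h₂ hX =>
    hY.step hum (by omega) (fun i h₁ h₂ => by rwa [show i = m + 1 by omega])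
      ⟨fun h => by omega, fun _ => ⟨h₁, h₂⟩, fun h => by omega, fun h => by omega⟩ hX
  obtain ⟨Y₁, Y₂, hne, hY₁, hY₂⟩ := h.exists_two
  by_cases hw : w (m - 1) ∧ w (m + 2)
  -- In the exceptional case one color may be lost, but then `w n` holds, as `Supply.of_almost`
  -- requires.
  · obtain ⟨B, hB⟩ := exists_meets_of_ne Y₁ Y₂ hne
    refine .of_almost hlu B (fun _ => hn ▸ hw.2) fun X hX hX' => ?_
    rcases hB X hX with h₁ | h₁
    · exact hrun Y₁ X hY₁ (fun _ => h₁) (fun h => absurd hw h) hX'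
    · exact hrun Y₂ X hY₂ (fun _ => h₁) (fun h => absurd hw h) hX'
  have key : ∀ X, (∃ Y, Reachable l u w c m Y ∧ interSize Y X ≤ 1) → BelowCompat l c n X →
      Reachable l u w c n X := fun X ⟨Y, hY, h⟩ hX =>
    hrun Y X hY (fun h => absurd h hw) (fun _ => h) hX
  by_cases hl' : l (n + 1)
  · have hln : ¬ l n := fun h => hlu ⟨h, hl'⟩
    have hbc : ∀ X, interSize (c (n + 1)) X = 0 → BelowCompat l c n X := fun X hX =>
      ⟨fun h => absurd h hln, fun _ => hX⟩
    have hun' : ¬ u (n + 1) := fun h => ht.between n _ rfl hun h hl'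
    cases h with
    | left B hl h h' =>
      -- This is the exceptional gap of length three below: only distinctness is known, and it
      -- suffices.
      have hne' : c m ≠ c (n + 1) := by
        refine (interSize_le_two_iff _ _).1 ((hc.three (by omega) hl
          (ht.below m _ rfl hl hum) (by rwa [← hn]) hl').1 ⟨hum, hno, by rwa [← hn]⟩)
      have hP : ∀ X, 1 ≤ interSize (c m) X → ∃ Y, Reachable l u w c m Y ∧ interSize Y X ≤ 1 := by
        intro X hX
        obtain ⟨Z₁, h₁, Z₂, h₂, hne⟩ := exists_two_disjoint_le_one _ _ hX
        by_cases e : Z₁ = B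
        · exact ⟨Z₂, h Z₂ h₂.1 fun e' => hne (e.trans e'.symm), h₂.2⟩
        · exact ⟨Z₁, h Z₁ h₁.1 e, h₁.2⟩
      obtain ⟨X₁, h₁, X₂, h₂, hne⟩ := exists_two_disjoint_one_le _ _ hne'
      exact .right (n + 1) rfl hl' X₁ X₂ hne h₁.1 h₂.1 (key _ (hP _ h₁.2) (hbc _ h₁.1))
        (key _ (hP _ h₂.2) (hbc _ h₂.1))
    | right k hk hl Z₁ Z₂ _ d₁ d₂ h₁ h₂ =>
      -- The gap of length two below is not exceptional, since `u (n + 1)` would create a triangle.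
      have hle : interSize (c k) (c (n + 1)) ≤ 1 :=
        (hc.two (by omega) hl (by rwa [show k + 1 = n by omega]) hl').2 fun h => hun' h.2
      have hge : 1 ≤ interSize (c (n + 1)) Z₁ := by
        refine one_le_of_le_one _ _ d₁ _ ?_
        rwa [interSize_comm]
      obtain ⟨X₁, e₁, X₂, e₂, hne⟩ := exists_two_disjoint_le_one _ _ hge
      refine .right (n + 1) rfl hl' X₁ X₂ hne e₁.1 e₂.1 (key _ ⟨Z₁, h₁, ?_⟩ (hbc _ e₁.1))
        (key _ ⟨Z₁, h₁, ?_⟩ (hbc _ e₂.1))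
      · rw [interSize_comm]; exact e₁.2
      · rw [interSize_comm]; exact e₂.2
    | free Z₁ Z₂ _ h =>
      refine .of_all hlu fun X => key X ?_
      obtain ⟨Y, h₁, h₂⟩ := exists_le_one_le_one Z₁ X
      exact ⟨Y, h Y (.inl h₁), h₂⟩
    | run_one k hk hl hu hr h =>
      refine .of_almost hlu (c k) (fun h => absurd h hln) fun X hX => key X ?_
      obtain ⟨Y, h₁, h₂⟩ := exists_two_le_le_one (c k) X hX
      exact ⟨Y, h Y h₁, h₂⟩
    | run_two k hk hl hu hu' h =>
      refine .of_all hlu fun X => key X ?_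
      obtain ⟨Y, h₁, h₂⟩ := exists_le_one_le_one (c k) X
      exact ⟨Y, h Y h₁, h₂⟩
    | run_three k hk hl hu hu' hu'' h =>
      refine .of_all hlu fun X => key X ?_
      obtain ⟨Y, h₁, h₂⟩ := exists_one_le_le_one (c k) X
      exact ⟨Y, h Y h₁, h₂⟩
  · by_cases hln : l n
    · refine .of_all hlu fun X hX => key X ?_ hX
      have hX' := hX.1 hln
      cases h with
      | left B hl h h' =>
        have hle : interSize (c m) (c n) ≤ 1 :=
          (hc.two (by omega) hl (ht.below m _ rfl hl hum) hln).2
            fun h => ht.between (m - 1) m (by omega) h.1 hum hl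
        obtain ⟨Z₁, h₁, Z₂, h₂, hne⟩ := exists_two_disjoint_le_one _ _
          (one_le_of_le_one _ _ hX' _ hle)
        by_cases e : Z₁ = B
        · exact ⟨Z₂, h Z₂ h₂.1 fun e' => hne (e.trans e'.symm), h₂.2⟩
        · exact ⟨Z₁, h Z₁ h₁.1 e, h₁.2⟩
      | right k hk hl Z₁ Z₂ _ d₁ d₂ h₁ h₂ =>
        exact ⟨Z₁, h₁, le_one_of_disjoint _ _ (hc.one (by omega) hl hln) _ d₁ _ hX'⟩
      | free Z₁ Z₂ _ h =>
        obtain ⟨Y, h₁, h₂⟩ := exists_le_one_le_one Z₁ X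
        exact ⟨Y, h Y (.inl h₁), h₂⟩
      | run_one k hk hl hu hr h =>
        have hge : 1 ≤ interSize (c k) (c n) := by
          refine (hc.three (by omega) hl (ht.below k _ rfl hl hu) ?_ hln).2 fun h => h.2.1 ?_
          · rwa [show k + 2 = m + 1 by omega]
          · rwa [← hk]
        obtain ⟨Y, h₁, h₂⟩ := exists_two_le_le_one (c k) X (by
          rintro rfl
          rw [interSize_comm] at hX'
          omega)
        exact ⟨Y, h Y h₁, h₂⟩
      | run_two k hk hl hu hu' h =>
        obtain ⟨Y, h₁, h₂⟩ := exists_le_one_le_one (c k) X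
        exact ⟨Y, h Y h₁, h₂⟩
      | run_three k hk hl hu hu' hu'' h =>
        obtain ⟨Y, h₁, h₂⟩ := exists_one_le_le_one (c k) X
        exact ⟨Y, h Y h₁, h₂⟩
    · refine .free Y₁ Y₂ hne fun X hX => key X ?_
        ⟨fun h => absurd h hln, fun h => absurd h hl'⟩
      rcases hX with h | h
      exacts [⟨Y₁, hY₁, h⟩, ⟨Y₂, hY₂, h⟩]

theorem Supply.add_three (ht : TriangleFreeRows l u w) (hc : RowValid l u c) {m n : ℤ}
    (hn : n = m + 3) (hum : u m) (hno : ¬ u (m + 1)) (hno' : ¬ u (m + 2)) (hun : u n)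
    (h : Supply l u w c m) : Supply l u w c n := by
  have hlu : ¬ (l n ∧ l (n + 1)) := fun h => ht.below n _ rfl h.1 hun h.2
  have hrun : ∀ Y X, Reachable l u w c m Y →
      (w m ∧ ¬ w (m + 1) ∧ w (m + 2) → interSize Y X ≤ 2) →
      (¬ (w m ∧ ¬ w (m + 1) ∧ w (m + 2)) → 1 ≤ interSize Y X) → BelowCompat l c n X →
      Reachable l u w c n X := fun Y X hY h₁ h₂ hX =>
    hY.step hum (by omega) (fun i h₁ h₂ => by
        rcases (by omega : i = m + 1 ∨ i = m + 2) with rfl | rfl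
        exacts [hno, hno'])
      ⟨fun h => by omega, fun h => by omega, fun _ => ⟨h₁, h₂⟩, fun h => by omega⟩ hX
  obtain ⟨Y₁, Y₂, hne, hY₁, hY₂⟩ := h.exists_two
  by_cases hw : w m ∧ ¬ w (m + 1) ∧ w (m + 2)
  · refine .of_all hlu fun X hX => ?_
    -- The exceptional condition only asks for distinct colors, and one of two distinct reachable
    -- colors differs from `X`.
    by_cases e : Y₁ = X
    · exact hrun Y₂ X hY₂ (fun _ => (interSize_le_two_iff _ _).2 fun e' => hne (e.trans e'.symm))
        (fun h => absurd hw h) hX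
    · exact hrun Y₁ X hY₁ (fun _ => (interSize_le_two_iff _ _).2 e) (fun h => absurd hw h) hX
  have key : ∀ X, (∃ Y, Reachable l u w c m Y ∧ 1 ≤ interSize Y X) → BelowCompat l c n X →
      Reachable l u w c n X := fun X ⟨Y, hY, h⟩ hX =>
    hrun Y X hY (fun h => absurd h hw) (fun _ => h) hX
  by_cases hln : l n
  · refine .of_all hlu fun X hX => key X ?_ hX
    have hX' := hX.1 hln
    have meets : ∀ D Z₁ Z₂, Z₁ ≠ Z₂ → interSize D Z₁ = 0 → interSize D Z₂ = 0 →
        Reachable l u w c m Z₁ → Reachable l u w c m Z₂ → 1 ≤ interSize D (c n) →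
        ∃ Y, Reachable l u w c m Y ∧ 1 ≤ interSize Y X := by
      intro D Z₁ Z₂ hne d₁ d₂ h₁ h₂ hge
      rcases meets_of_two_disjoint D Z₁ d₁ Z₂ d₂ hne X (by
          rintro rfl
          rw [interSize_comm] at hX'
          omega) with h | h
      exacts [⟨Z₁, h₁, h⟩, ⟨Z₂, h₂, h⟩]
    cases h with
    | left B hl h h' =>
      obtain ⟨Z₁, h₁, Z₂, h₂, hne⟩ := exists_two_disjoint (c m) B
      refine meets (c m) Z₁ Z₂ hne h₁.1 h₂.1 (h _ h₁.1 h₁.2) (h _ h₂.1 h₂.2) ?_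
      have hlm : ¬ l (m + 1) := ht.below m _ rfl hl hum
      -- Either way `c m` meets `c n`: through the intermediate color, or by the default condition
      -- for a gap of three.
      by_cases hl' : l (m + 2)
      · rw [interSize_comm]
        refine one_le_of_disjoint _ (c (m + 2)) ?_ _ ?_
        · rw [interSize_comm]
          exact hc.one (by omega) hl' hln
        · rw [interSize_comm]
          exact (hc.two rfl hl hlm hl').2 fun h => hno' h.2
      · exact (hc.three hn hl hlm hl' hln).2 fun h => hno' h.2.2
    | right k hk hl Z₁ Z₂ hne d₁ d₂ h₁ h₂ =>
      refine meets (c k) Z₁ Z₂ hne d₁ d₂ h₁ h₂ ?_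
      by_cases hl' : l (k + 1)
      · refine one_le_of_disjoint _ (c (k + 1)) (hc.one rfl hl hl') _ ?_
        rw [hc.one (by omega) hl' hln]
        omega
      -- Here the exceptional clause for a gap of length two is used: `u` has vertices just left of
      -- `k` and at `n`.
      · exact (hc.two (by omega) hl hl' hln).1 ⟨by rwa [show k - 1 = m by omega], hun⟩
    | free Z₁ Z₂ _ h =>
      obtain ⟨Y, h₁, h₂⟩ := exists_le_one_one_le Z₁ X
      exact ⟨Y, h Y (.inl h₁), h₂⟩
    | run_one k hk hl hu hr h =>
      obtain ⟨Y, h₁, h₂⟩ := exists_two_le_one_le (c k) X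
      exact ⟨Y, h Y h₁, h₂⟩
    | run_two k hk hl hu hu' h =>
      obtain ⟨Y, h₁, h₂⟩ := exists_le_one_one_le (c k) X
      exact ⟨Y, h Y h₁, h₂⟩
    | run_three k hk hl hu hu' hu'' h =>
      obtain ⟨Y, h₁, h₂⟩ := exists_two_le_one_le (c k) X
      exact ⟨Y, h Y (by omega), h₂⟩
  · obtain ⟨B, hB⟩ := exists_meets_of_ne Y₁ Y₂ hne
    refine .of_almost hlu B (fun h => absurd h hln) fun X hX => key X ?_
    rcases hB X hX with h | h
    exacts [⟨Y₁, hY₁, h⟩, ⟨Y₂, hY₂, h⟩]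

theorem Supply.add_four (ht : TriangleFreeRows l u w) {m n : ℤ}
    (hn : n = m + 4) (hum : u m) (hno : ¬ u (m + 1)) (hno' : ¬ u (m + 2)) (hno'' : ¬ u (m + 3))
    (hun : u n) (h : Supply l u w c m) : Supply l u w c n := by
  have hlu : ¬ (l n ∧ l (n + 1)) := fun h => ht.below n _ rfl h.1 hun h.2
  obtain ⟨Y₁, Y₂, hne, hY₁, hY₂⟩ := h.exists_two
  have key : ∀ Y X, Reachable l u w c m Y → Y ≠ X → BelowCompat l c n X →
      Reachable l u w c n X := fun Y X hY hYX hX =>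
    hY.step hum (by omega) (fun i h₁ h₂ => by
        rcases (by omega : i = m + 1 ∨ i = m + 2 ∨ i = m + 3) with rfl | rfl | rfl
        exacts [hno, hno', hno''])
      ⟨fun h => by omega, fun h => by omega, fun h => by omega,
        fun _ => (interSize_le_two_iff _ _).2 hYX⟩ hX
  refine .of_all hlu fun X hX => ?_
  by_cases e : Y₁ = X
  · exact key Y₂ X hY₂ (fun e' => hne (e.trans e'.symm)) hX
  · exact key Y₁ X hY₁ e hX

theorem supply_of_validUpTo (ht : TriangleFreeRows l u w) {n : ℤ} {f : ℤ → Fin 35}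
    (hf : ValidUpTo l u w c (n - 1) f) (hno : ∀ i, n - 4 ≤ i → i < n → ¬ u i) (hun : u n) :
    Supply l u w c n :=
  .of_all (fun h => ht.below n _ rfl h.1 hun h.2) fun _ hX => hf.reachable_of_far hno hX

theorem exists_validUpTo (ht : TriangleFreeRows l u w) (hc : RowValid l u c) (a : ℤ)
    (ha : ∀ n < a, ¬ u n) (k : ℕ) :
    (∃ f, ValidUpTo l u w c (a - 1 + k) f) ∧
      ∀ n, n ≤ a - 1 + k → u n → Supply l u w c n := by
  induction k with
  | zero =>
    refine ⟨⟨fun _ => 0, fun n hn hun => absurd hun (ha n (by simp at hn; omega)),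
      fun m n hn _ _ hun => absurd hun (ha n (by simp at hn; omega))⟩,
      fun n hn hun => absurd hun (ha n (by simp at hn; omega))⟩
  | succ k ih =>
    obtain ⟨⟨f, hf⟩, hs⟩ := ih
    obtain ⟨N, hN⟩ : ∃ N : ℤ, N = a - 1 + (k + 1 : ℕ) := ⟨_, rfl⟩
    have hN' : a - 1 + (k : ℤ) = N - 1 := by push_cast at hN; omega
    rw [hN'] at hf hs
    rw [← hN]
    have hsN : u N → Supply l u w c N := by
      intro hun
      by_cases h₁ : u (N - 1)
      · exact (hs _ le_rfl h₁).succ ht hc (by omega) h₁ hun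
      by_cases h₂ : u (N - 2)
      · exact (hs _ (by omega) h₂).add_two ht hc (by omega) h₂
          (by rwa [show N - 2 + 1 = N - 1 by omega]) hun
      by_cases h₃ : u (N - 3)
      · exact (hs _ (by omega) h₃).add_three ht hc (by omega) h₃
          (by rwa [show N - 3 + 1 = N - 2 by omega]) (by rwa [show N - 3 + 2 = N - 1 by omega]) hun
      by_cases h₄ : u (N - 4)
      · exact (hs _ (by omega) h₄).add_four ht (by omega) h₄
          (by rwa [show N - 4 + 1 = N - 3 by omega]) (by rwa [show N - 4 + 2 = N - 2 by omega])
          (by rwa [show N - 4 + 3 = N - 1 by omega]) hun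
      refine supply_of_validUpTo ht hf (fun i hi₁ hi₂ => ?_) hun
      rcases (by omega : i = N - 1 ∨ i = N - 2 ∨ i = N - 3 ∨ i = N - 4) with rfl | rfl | rfl | rfl
      exacts [h₁, h₂, h₃, h₄]
    constructor
    · by_cases hun : u N
      · obtain ⟨_, _, _, ⟨g, _, hg⟩, _⟩ := (hsN hun).exists_two
        exact ⟨g, hg⟩
      · exact ⟨f, hf.of_not_mem hun⟩
    · intro n hn hun
      rcases eq_or_lt_of_le hn with rfl | hlt
      · exact hsN hun
      · exact hs n (by omega) hun

/-- A bounded row can be colored above a validly colored row. -/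
theorem exists_rowValid (ht : TriangleFreeRows l u w) (hc : RowValid l u c) (a b : ℤ)
    (hab : ∀ n, u n → a ≤ n ∧ n ≤ b) :
    ∃ f, RowValid u w f ∧ ∀ n, u n → BelowCompat l c n (f n) := by
  obtain ⟨⟨f, hf⟩, -⟩ := exists_validUpTo ht hc a
    (fun n hn hun => absurd (hab n hun).1 (by omega)) (b - a + 1).toNat
  have hle : ∀ n, u n → n ≤ a - 1 + ((b - a + 1).toNat : ℤ) := fun n hun => by
    have := hab n hun
    omega
  exact ⟨f, fun m n hmn hum hun => hf.2 m n (hle n hun) hmn hum hun,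
    fun n hun => hf.1 n (hle n hun) hun⟩

end

/-! ### Homomorphism to the Kneser graph -/

theorem interSize_self_ne_zero (i : Fin 35) : interSize i i ≠ 0 := by
  intro h
  exact (interSize_le_two_iff i i).1 (by omega) rfl

/-- The Kneser graph of the three-element subsets of a set of seven elements. -/
def tripleGraph : SimpleGraph (Fin 35) where
  Adj i j := interSize i j = 0
  symm := ⟨fun i j h => by rwa [interSize_comm]⟩
  loopless := ⟨fun i h => interSize_self_ne_zero i h⟩

theorem triangleFreeRows_of_triangleFree {S : Set (ℤ × ℤ)}
    (hS : ∀ p ∈ S, ∀ q ∈ S, ∀ r ∈ S, triangularLattice.Adj p q → triangularLattice.Adj q r →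
      ¬ triangularLattice.Adj p r) (y : ℤ) :
    TriangleFreeRows (fun n => (n, y) ∈ S) (fun n => (n, y + 1) ∈ S)
      (fun n => (n, y + 1 + 1) ∈ S) where
  below := by
    rintro a b rfl h₁ h₂ h₃
    refine hS _ h₁ _ h₂ _ h₃ ?_ ?_ ?_ <;> simp [triangularLattice]
  between := by
    rintro a b rfl h₁ h₂ h₃
    refine hS _ h₁ _ h₂ _ h₃ ?_ ?_ ?_ <;> simp [triangularLattice]
  above := by
    rintro a b rfl h₁ h₂ h₃
    refine hS _ h₁ _ h₂ _ h₃ ?_ ?_ ?_ <;> simp [triangularLattice]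

theorem exists_tripleColoring_rows {S : Set (ℤ × ℤ)}
    (hS : ∀ p ∈ S, ∀ q ∈ S, ∀ r ∈ S, triangularLattice.Adj p q → triangularLattice.Adj q r →
      ¬ triangularLattice.Adj p r) {N : ℤ} (hN : ∀ p ∈ S, |p.1| ≤ N ∧ |p.2| < N) (k : ℕ) :
    ∃ f : ℤ → ℤ → Fin 35, (∀ y ≤ -N + k,
      RowValid (fun n => (n, y) ∈ S) (fun n => (n, y + 1) ∈ S) (f y)) ∧
      ∀ y ≤ -N + k, ∀ n, (n, y) ∈ S →
        BelowCompat (fun n => (n, y - 1) ∈ S) (f (y - 1)) n (f y n) := by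
  induction k with
  | zero =>
    -- The strict bound on the second coordinate makes row `-N` empty, so the induction starts with
    -- a vacuous coloring.
    have hempty : ∀ y ≤ -N + ((0 : ℕ) : ℤ), ∀ n, (n, y) ∉ S := fun y hy n h => by
      have := neg_abs_le y
      have := (hN _ h).2
      simp at hy this
      omega
    exact ⟨fun _ _ => 0, fun y hy m n _ h => absurd h (hempty y hy m),
      fun y hy n h => absurd h (hempty y hy n)⟩
  | succ k ih =>
    obtain ⟨f, hf₁, hf₂⟩ := ih
    obtain ⟨y, hy⟩ : ∃ y : ℤ, y = -N + k := ⟨_, rfl⟩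
    have hy' : -N + ((k + 1 : ℕ) : ℤ) = y + 1 := by push_cast; omega
    rw [← hy] at hf₁ hf₂
    rw [hy']
    obtain ⟨g, hg₁, hg₂⟩ := exists_rowValid (triangleFreeRows_of_triangleFree hS y)
      (hf₁ y le_rfl) (-N) N (fun n h => by
        have := (hN _ h).1
        rw [abs_le] at this
        exact this)
    refine ⟨Function.update f (y + 1) g, fun z hz => ?_, fun z hz n h => ?_⟩
    · rcases eq_or_ne z (y + 1) with rfl | hne
      · rwa [Function.update_self]
      · rw [Function.update_of_ne hne]
        exact hf₁ z (by omega)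
    · rw [Function.update_of_ne (by omega : z - 1 ≠ y + 1)]
      rcases eq_or_ne z (y + 1) with rfl | hne
      · rw [Function.update_self, add_sub_cancel_right]
        exact hg₂ n h
      · rw [Function.update_of_ne hne]
        exact hf₂ z (by omega) n h

/-- Finite triangle-free induced subgraphs of the triangular lattice map to the Kneser graph. -/
theorem exists_tripleColoring_of_finite {S : Set (ℤ × ℤ)} (hfin : S.Finite)
    (hS : ∀ p ∈ S, ∀ q ∈ S, ∀ r ∈ S, triangularLattice.Adj p q → triangularLattice.Adj q r →
      ¬ triangularLattice.Adj p r) :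
    ∃ f : ℤ × ℤ → Fin 35, ∀ p ∈ S, ∀ q ∈ S, triangularLattice.Adj p q →
      interSize (f p) (f q) = 0 := by
  obtain ⟨N, hN⟩ := (hfin.image fun p => |p.1| + |p.2|).bddAbove
  have hN' : ∀ p ∈ S, |p.1| ≤ N + 1 ∧ |p.2| < N + 1 := fun p hp => by
    have h₁ : |p.1| + |p.2| ≤ N := hN ⟨p, hp, rfl⟩
    have h₂ := abs_nonneg p.1
    have h₃ := abs_nonneg p.2
    omega
  obtain ⟨f, hf₁, hf₂⟩ := exists_tripleColoring_rows hS hN' (2 * (N + 1)).toNat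
  have hle : ∀ p ∈ S, p.2 ≤ -(N + 1) + ((2 * (N + 1)).toNat : ℤ) := fun p hp => by
    have h₁ := (hN' p hp).2
    have h₂ := le_abs_self p.2
    omega
  have row : ∀ x y, (x, y) ∈ S → (x + 1, y) ∈ S → interSize (f y x) (f y (x + 1)) = 0 :=
    fun x y h h' => (hf₁ y (hle _ h)).one rfl h h'
  have up : ∀ x y, (x, y) ∈ S → (x, y - 1) ∈ S → interSize (f (y - 1) x) (f y x) = 0 :=
    fun x y h h' => (hf₂ y (hle _ h) x h).1 h'
  have diag : ∀ x y, (x, y) ∈ S → (x + 1, y - 1) ∈ S →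
      interSize (f (y - 1) (x + 1)) (f y x) = 0 := fun x y h h' => (hf₂ y (hle _ h) x h).2 h'
  refine ⟨fun p => f p.2 p.1, ?_⟩
  rintro ⟨x, y⟩ hp q hq (rfl | rfl | rfl | rfl | rfl | rfl)
  · rw [interSize_comm]
    simpa using row (x - 1) y hq (by simpa using hp)
  · exact row x y hp hq
  · simpa using diag (x - 1) (y + 1) hq (by simpa using hp)
  · simpa using up x (y + 1) hq (by simpa using hp)
  · rw [interSize_comm]
    exact up x y hp hq
  · rw [interSize_comm]
    exact diag x y hp hq

theorem not_adj_of_cliqueFree {V : Type*} {G : SimpleGraph V} {S : Set V}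
    (hS : (G.induce S).CliqueFree 3) (p : V) (hp : p ∈ S) (q : V) (hq : q ∈ S) (r : V)
    (hr : r ∈ S) (hpq : G.Adj p q) (hqr : G.Adj q r) : ¬ G.Adj p r := by
  classical
  intro hpr
  exact hS {⟨p, hp⟩, ⟨q, hq⟩, ⟨r, hr⟩}
    (SimpleGraph.is3Clique_triple_iff.2
      ⟨by simpa using hpq, by simpa using hpr, by simpa using hqr⟩)

/-- Compactness applies because the target graph is finite. -/
theorem nonempty_hom_tripleGraph (S : Set (ℤ × ℤ))
    (hS : (triangularLattice.induce S).CliqueFree 3) :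
    Nonempty (triangularLattice.induce S →g tripleGraph) := by
  refine SimpleGraph.nonempty_hom_of_forall_finite_subgraph_hom fun G' hG' => ?_
  have h := exists_tripleColoring_of_finite (hG'.image Subtype.val) (by
    rintro _ ⟨p, -, rfl⟩ _ ⟨q, -, rfl⟩ _ ⟨r, -, rfl⟩
    exact not_adj_of_cliqueFree hS _ p.2 _ q.2 _ r.2)
  exact ⟨fun v => h.choose v.1.1, fun {v w} hvw => h.choose_spec _ ⟨v.1, v.2, rfl⟩ _
    ⟨w.1, w.2, rfl⟩ (G'.adj_sub hvw)⟩

/-! ### From the homomorphism to all ratios at least 7/3 -/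

/-- From every set of `a` colors one can choose `b` colors for each vertex, disjointly for adjacent
vertices. -/
def HasMulticoloring {V : Type*} (G : SimpleGraph V) (a b : ℕ) : Prop :=
  ∀ A : Finset ℕ, A.card = a →
    ∃ c : V → Finset ℕ, (∀ v, c v ⊆ A ∧ (c v).card = b) ∧ ∀ v w, G.Adj v w → Disjoint (c v) (c w)

section

variable {V : Type*} {G : SimpleGraph V}

theorem HasMulticoloring.isColorableAB {a b : ℕ} (h : HasMulticoloring G a b) :
    IsColorableAB G a b := by
  intro L hL hconst
  rcases isEmpty_or_nonempty V with hV | ⟨⟨v₀⟩⟩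
  · exact ⟨fun _ => ∅, fun v => isEmptyElim v, fun v => isEmptyElim v⟩
  · obtain ⟨c, hc, hd⟩ := h (L v₀) (hL v₀)
    exact ⟨c, fun v => hconst v v₀ ▸ hc v, hd⟩

theorem HasMulticoloring.add {a b a' b' : ℕ} (h : HasMulticoloring G a b)
    (h' : HasMulticoloring G a' b') : HasMulticoloring G (a + a') (b + b') := by
  intro A hA
  obtain ⟨B, hBA, hB⟩ := Finset.exists_subset_card_eq (show a ≤ A.card by omega)
  obtain ⟨c, hc, hd⟩ := h B hB
  obtain ⟨c', hc', hd'⟩ := h' (A \ B) (by rw [Finset.card_sdiff_of_subset hBA]; omega)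
  have hdisj : ∀ v w, Disjoint (c v) (c' w) := fun v w =>
    Finset.disjoint_of_subset_left (hc v).1
      (Finset.disjoint_of_subset_right (hc' w).1 Finset.disjoint_sdiff)
  refine ⟨fun v => c v ∪ c' v, fun v => ⟨?_, ?_⟩, fun v w hvw => ?_⟩
  · exact Finset.union_subset ((hc v).1.trans hBA) ((hc' v).1.trans Finset.sdiff_subset)
  · rw [Finset.card_union_of_disjoint (hdisj v v), (hc v).2, (hc' v).2]
  · rw [Finset.disjoint_union_left, Finset.disjoint_union_right, Finset.disjoint_union_right]
    exact ⟨⟨hd v w hvw, hdisj v w⟩, (hdisj w v).symm, hd' v w hvw⟩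

theorem HasMulticoloring.zero (G : SimpleGraph V) (a : ℕ) : HasMulticoloring G a 0 := fun _ _ =>
  ⟨fun _ => ∅, fun _ => ⟨Finset.empty_subset _, rfl⟩, fun _ _ _ => Finset.disjoint_empty_left _⟩

theorem HasMulticoloring.mono {a a' b : ℕ} (h : HasMulticoloring G a b) (ha : a ≤ a') :
    HasMulticoloring G a' b := by
  simpa [Nat.add_sub_cancel' ha] using h.add (.zero G (a' - a))

theorem HasMulticoloring.mul {a b : ℕ} (h : HasMulticoloring G a b) (k : ℕ) :
    HasMulticoloring G (k * a) (k * b) := by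
  induction k with
  | zero => simpa using HasMulticoloring.zero G 0
  | succ k ih => simpa [Nat.succ_mul] using ih.add h

theorem HasMulticoloring.of_hom {W : Type*} {H : SimpleGraph W} (φ : G →g H) {a b : ℕ}
    (t : W → Finset (Fin a)) (ht : ∀ i, (t i).card = b)
    (hd : ∀ i j, H.Adj i j → Disjoint (t i) (t j)) : HasMulticoloring G a b := by
  intro A hA
  refine ⟨fun v => (t (φ v)).map (A.orderEmbOfFin hA).toEmbedding, fun v => ⟨?_, ?_⟩,
    fun v w hvw => ?_⟩
  · intro x hx
    obtain ⟨i, -, rfl⟩ := Finset.mem_map.1 hx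
    exact A.orderEmbOfFin_mem hA i
  · rw [Finset.card_map, ht]
  · rw [Finset.disjoint_map]
    exact hd _ _ (φ.map_adj hvw)

end

/-- The set of binary digits one of `x`, among the first `n` digits. -/
def bitSet (n x : ℕ) : Finset (Fin n) :=
  Finset.univ.filter fun k => x.testBit k

theorem disjoint_bitSet {n x y : ℕ} (h : ∀ k < n, ¬ (x.testBit k ∧ y.testBit k)) :
    Disjoint (bitSet n x) (bitSet n y) := by
  rw [Finset.disjoint_left]
  intro k hx hy
  simp only [bitSet, Finset.mem_filter, Finset.mem_univ, true_and] at hx hy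
  exact h k k.isLt ⟨hx, hy⟩

/-- A homomorphism from the triples of seven elements to the pairs of five elements, as a packed
list of five-digit bit masks. -/
def pairMask (i : Fin 35) : ℕ :=
  Nat.mod (Nat.shiftRight 37076499127437479355097439414910593929501672656178275 (Nat.mul 5 i.val)) 32

/-- A proper coloring of the triples of seven elements with three colors. -/
def tripleColor (i : Fin 35) : Fin 3 :=
  if (tripleMask i).testBit 0 then 0 else if (tripleMask i).testBit 1 then 1 else 2

theorem hasMulticoloring_seven_three {V : Type*} {G : SimpleGraph V} (φ : G →g tripleGraph) :
    HasMulticoloring G 7 3 := by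
  refine .of_hom φ (fun i => bitSet 7 (tripleMask i)) (by decide +kernel) fun i j h => ?_
  have key : ∀ i j : Fin 35, interSize i j = 0 →
      ∀ k < 7, ¬ ((tripleMask i).testBit k ∧ (tripleMask j).testBit k) := by
    decide +kernel
  exact disjoint_bitSet (key i j h)

theorem hasMulticoloring_five_two {V : Type*} {G : SimpleGraph V} (φ : G →g tripleGraph) :
    HasMulticoloring G 5 2 := by
  refine .of_hom φ (fun i => bitSet 5 (pairMask i)) (by decide +kernel) fun i j h => ?_
  have key : ∀ i j : Fin 35, interSize i j = 0 →
      ∀ k < 5, ¬ ((pairMask i).testBit k ∧ (pairMask j).testBit k) := by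
    decide +kernel
  exact disjoint_bitSet (key i j h)

theorem hasMulticoloring_three_one {V : Type*} {G : SimpleGraph V} (φ : G →g tripleGraph) :
    HasMulticoloring G 3 1 := by
  refine .of_hom φ (fun i => {tripleColor i}) (fun i => Finset.card_singleton _) fun i j h => ?_
  -- Triples sharing 0 or sharing 1 meet, and so do any two triples inside the remaining five
  -- points.
  have key : ∀ i j : Fin 35, interSize i j = 0 → tripleColor i ≠ tripleColor j := by
    decide +kernel
  exact Finset.disjoint_singleton.2 (key i j h)

/-- For `b = 3q + r` the least admissible `a` is `7q`, `7q + 3` or `7q + 5`, according to `r = 0, 1,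
2`. -/
theorem hasMulticoloring_of_hom {V : Type*} {G : SimpleGraph V} (φ : G →g tripleGraph) {a b : ℕ}
    (h : 7 * b ≤ 3 * a) : HasMulticoloring G a b := by
  have h₇ := (hasMulticoloring_seven_three φ).mul (b / 3)
  have hb := Nat.div_add_mod b 3
  rcases (by omega : b % 3 = 0 ∨ b % 3 = 1 ∨ b % 3 = 2) with hr | hr | hr
  · rw [show b / 3 * 3 = b by omega] at h₇
    exact h₇.mono (by omega)
  · have h₁ := h₇.add (hasMulticoloring_three_one φ)
    rw [show b / 3 * 3 + 1 = b by omega] at h₁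
    exact h₁.mono (by omega)
  · have h₂ := h₇.add (hasMulticoloring_five_two φ)
    rw [show b / 3 * 3 + 2 = b by omega] at h₂
    exact h₂.mono (by omega)

theorem theorem6 (S : Set (ℤ × ℤ)) (hS : (triangularLattice.induce S).CliqueFree 3) :
    MemColorClass (7 / 3) (triangularLattice.induce S) ∧
      IsColorableAB (triangularLattice.induce S) 7 3 := by
  obtain ⟨φ⟩ := nonempty_hom_tripleGraph S hS
  refine ⟨fun a b hb hab => (hasMulticoloring_of_hom φ ?_).isColorableAB,
    (hasMulticoloring_seven_three φ).isColorableAB⟩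
  rw [div_le_div_iff₀ (by norm_num) (by exact_mod_cast hb)] at hab
  have : 7 * b ≤ a * 3 := by exact_mod_cast hab
  omega
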